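/- Let $G$ be a countable amenable group, let $X$ and $Y$ be compact metric spaces on which $G$ acts by homeomorphisms, and let $\pi : X \to Y$ be a factor map, i.e. a continuous surjection with $\pi(gx) = g\pi(x)$ for all $g \in G$, $x \in X$. A Følner sequence of $G$ is an increasing sequence $(F_n)$ of finite subsets of $G$ with $e \in F_n$ for all $n$, $\bigcup_n F_n = G$ and $\lim_{n} |gF_n \bigtriangleup F_n|/|F_n| = 0$ for every $g \in G$. The topological Rokhlin dimension $\dim_{\mathrm{Rok}}(Y,G)$ is the smallest integer $D \ge 0$ with the following property: there is a Følner sequence $(F_n)$ such that for every $n$ there are (nonempty) open sets $U_0,\dots,U_D \subset Y$ such that, for every $i$, the sets $g\overline{U_i}$ ($g \in F_n$) are pairwise disjoint, and $\bigcup_{i=0}^{D} F_nU_i = Y$. For a finite open cover $\mathcal U$ of $X$, let $\mathrm{ord}(\mathcal U) = -1 + \max_{x \in X} |\{O \in \mathcal U : x \in O\}|$, let $D(\mathcal U)$ be the minimum of $\mathrm{ord}(\mathcal V)$ over all finite open covers $\mathcal V$ refining $\mathcal U$, and for a finite set $A \subset G$ put $\mathcal U_A = \bigvee_{g \in A} g^{-1}(\mathcal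 U)$. The mean dimension is $$\mathrm{mdim}(X,G) = \sup_{\mathcal U} \lim_{n\to\infty} \frac{D(\mathcal U_{F_n})}{|F_n|},$$ where $\mathcal U$ runs over all finite open covers of $X$ and $(F_n)$ is any Følner sequence of $G$ (the limit exists and does not depend on the choice of $(F_n)$). For a continuous map $f : X \to [0,1]^m$ let $I_f : X \to ([0,1]^m)^G$ be given by $(I_f(x))_g = f(gx)$. **Theorem.** Let $D \ge 0$ and $L \ge 1$ be integers with $\dim_{\mathrm{Rok}}(Y,G) = D$ and $\mathrm{mdim}(X,G) < L/2$. Then the set $$A = \{ f \in C(X,[0,1]^{(D+1)L}) : I_f \times \pi : X \to ([0,1]^{(D+1)L})^G \times Y,\ x \mapsto (I_f(x), \pi(x)), \text{ is a (topological) embedding} \}$$ is a dense $G_\delta$ subset of $C(X,[0,1]^{(D+1)L})$ with the topology of uniform convergence. In particular, $A \neq \varnothing$. -/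

import Mathlib

open Set Filter Topology
open scoped Pointwise ENNReal symmDiff

noncomputable section

namespace TopDyn

/-- A Følner sequence in a group `G`: an increasing sequence of finite subsets containing the
identity, exhausting `G`, with `|g Fₙ ∆ Fₙ| / |Fₙ| → 0` for every `g`. -/
structure IsFolnerSeq {G : Type*} [Group G] (F : ℕ → Finset G) : Prop where
  mono : Monotone F
  one_mem : ∀ n, (1 : G) ∈ F n
  exhausts : ∀ g : G, ∃ n, g ∈ F n
  tendsto : ∀ g : G,
    Tendsto (fun n => (((g • (F n : Set G)) ∆ (F n : Set G)).ncard : ℝ) / ((F n).card : ℝ))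
      atTop (𝓝 0)

/-- A factor map between `G`-systems: a continuous equivariant surjection. -/
structure IsFactorMap (G : Type*) {X Y : Type*} [Group G] [TopologicalSpace X]
    [TopologicalSpace Y] [MulAction G X] [MulAction G Y] (π : X → Y) : Prop where
  continuous : Continuous π
  surjective : Function.Surjective π
  map_smul : ∀ (g : G) (x : X), π (g • x) = g • π x

/-! ### Topological Rokhlin dimension -/

/-- `(U, S)` is a tower: `U` is nonempty and the levels `g U`, `g ∈ S`, are pairwise disjoint. -/
def IsTower {G X : Type*} [Group G] [MulAction G X] (U : Set X) (S : Finset G) : Prop :=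
  U.Nonempty ∧ (S : Set G).PairwiseDisjoint (fun g => g • U)

/-- The property whose smallest `D` is the topological Rokhlin dimension: for some Følner
sequence `F` and every `n`, there are open sets `U₀, …, U_D` such that each `closure Uᵢ` is the
base of a tower of shape `Fₙ` and the sets `Fₙ Uᵢ` cover the space. -/
def RokhlinProperty (X G : Type*) [Group G] [TopologicalSpace X] [MulAction G X] (D : ℕ) : Prop :=
  ∃ F : ℕ → Finset G, IsFolnerSeq F ∧ ∀ n, ∃ U : Fin (D + 1) → Set X,
    (∀ i, IsOpen (U i)) ∧
    (∀ i, IsTower (closure (U i)) (F n)) ∧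
    (⋃ i, ⋃ g ∈ F n, g • U i) = univ

/-- The topological Rokhlin dimension of `(X, G)` (infinite if no `D` has the property). -/
def dimRok (X G : Type*) [Group G] [TopologicalSpace X] [MulAction G X] : ℕ∞ :=
  ⨅ (D : ℕ) (_ : RokhlinProperty X G D), (D : ℕ∞)

/-! ### Mean dimension -/

/-- Finite open covers of `X`. -/
structure IsFinOpenCover {X : Type*} [TopologicalSpace X] (𝒰 : Set (Set X)) : Prop where
  finite : 𝒰.Finite
  isOpen : ∀ O ∈ 𝒰, IsOpen O
  covers : ⋃₀ 𝒰 = univ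

/-- `ord 𝒰 = -1 + max_x ∑_{O ∈ 𝒰} 1_O(x)`. -/
def ord {X : Type*} (𝒰 : Set (Set X)) : ℕ∞ :=
  (⨆ x : X, {O ∈ 𝒰 | x ∈ O}.encard) - 1

/-- `𝒱` refines `𝒰`: every member of `𝒱` is contained in a member of `𝒰`. -/
def Refines {X : Type*} (𝒱 𝒰 : Set (Set X)) : Prop :=
  ∀ V ∈ 𝒱, ∃ U ∈ 𝒰, V ⊆ U

/-- `D(𝒰)`: the least order of a finite open cover refining `𝒰`. -/
def coverDim {X : Type*} [TopologicalSpace X] (𝒰 : Set (Set X)) : ℕ∞ :=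
  ⨅ (𝒱 : Set (Set X)) (_ : IsFinOpenCover 𝒱 ∧ Refines 𝒱 𝒰), ord 𝒱

/-- The join `𝒰_A = ⋁_{g ∈ A} g⁻¹(𝒰)`: all sets `⋂_{g ∈ A} g⁻¹ U_g` with every `U_g ∈ 𝒰`. -/
def orbitJoin {G X : Type*} [Group G] [MulAction G X] (𝒰 : Set (Set X)) (A : Finset G) :
    Set (Set X) :=
  {W | ∃ U : G → Set X, (∀ g ∈ A, U g ∈ 𝒰) ∧ W = ⋂ g ∈ A, (fun x : X => g • x) ⁻¹' U g}

/-- The mean dimension of `(X, G)`, computed along the Følner sequence `F`: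
`sup_𝒰 lim_n D(𝒰_{Fₙ}) / |Fₙ|`. The limit exists and is independent of the Følner sequence by the
Ornstein–Weiss lemma; in the definition it is written as an upper limit. -/
def mdim (X : Type*) {G : Type*} [Group G] [TopologicalSpace X] [MulAction G X]
    (F : ℕ → Finset G) : ℝ≥0∞ :=
  ⨆ (𝒰 : Set (Set X)) (_ : IsFinOpenCover 𝒰),
    limsup (fun n => ((coverDim (orbitJoin 𝒰 (F n)) : ℕ∞) : ℝ≥0∞) / ((F n).card : ℝ≥0∞)) atTop

/-! ### Induced maps into cubical shifts -/

/-- The cube `[0,1]^m`. -/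
abbrev Cube (m : ℕ) : Type := Fin m → unitInterval

/-- The induced map `I_f : X → ([0,1]^m)^G`, `(I_f x)_g = f (g x)`. -/
def inducedMap (G : Type*) {X : Type*} [Group G] [TopologicalSpace X] [MulAction G X] {m : ℕ}
    (f : C(X, Cube m)) : X → G → Cube m :=
  fun x g => f (g • x)

end TopDyn

end

/-! The set `A` is the intersection over `n` of the sets of `f` for which `(I_f, π)` identifies no
two points at distance at least `1 / (n + 1)`. Compactness makes each of them open
(`isOpen_setOf_separating`), so by Baire it suffices that each is dense (`exists_close_separating`).

Density: given `f`, take a cover of small mesh. Since the mean dimension is below `L / 2`, its join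
over some Rokhlin shape `S` is refined by a cover of order `r` with `2r < L|S|`. The Følner sequence
of the towers need not be the one that computes the mean dimension; the Ornstein–Weiss covering
argument (`eventuallyLe_of_subadditive`), applied to the subadditive function `E ↦ D(𝒰_E)`,
transfers the bound (`exists_hasOrderLe_orbitJoin`).

Split the `(D + 1)L` coordinates into one block of `L` per tower. For tower `i`, the block-`i`
values of `f` along `S x` form a map into a cube of dimension `L|S|`. Mapping the nerve of the
refining cover there in general position gives a nearby `Φ i` such that `Φ i x = Φ i x'` forces `x,
x'` into a common member (`exists_approx_separating`), so `s x` and `s x'` are close for all `s ∈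
S`. On the preimage of the level `s (closure (U i))`, let block `i` of the new map at `y` be the
`s`-component of `Φ i (s⁻¹ y)`; disjointness of the closed levels allows gluing (`exists_glue`). If
`π x = π x'` lies in `h U i`, then the orbit values over `S h⁻¹` recover `Φ i (h⁻¹ x)`, and `h ∈ S`
gives that `x` and `x'` are close. -/

noncomputable section

namespace TopDyn

/-! ### The Ornstein–Weiss inequality -/

section OrnsteinWeiss

variable {G : Type*} [Group G] [DecidableEq G]

/-- The number of elements that left translation by `g` moves out of `E`. -/
def escape (g : G) (E : Finset G) : ℕ := (E.filter (fun c => g * c ∉ E)).card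

theorem escape_union_le (g : G) (S T : Finset G) :
    escape g (S ∪ T) ≤ escape g S + escape g T := by
  unfold escape
  refine le_trans (Finset.card_le_card ?_) (Finset.card_union_le _ _)
  intro c hc
  simp only [Finset.mem_filter, Finset.mem_union] at hc ⊢
  tauto

theorem escape_image_mul_right_le (g c : G) (E : Finset G) :
    escape g (E.image (· * c)) ≤ escape g E := by
  unfold escape
  refine le_trans (Finset.card_le_card (t := (E.filter (fun x => g * x ∉ E)).image (· * c)) ?_)
    Finset.card_image_le
  intro x hx
  simp only [Finset.mem_filter, Finset.mem_image, not_exists, not_and] at hx ⊢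
  obtain ⟨⟨a, ha, rfl⟩, h⟩ := hx
  exact ⟨a, ⟨ha, fun h' => h _ h' (by group)⟩, rfl⟩

/-- The elements that `g` and `g⁻¹` keep inside `T` correspond under translation, so equally many
escape in both directions. -/
theorem card_filter_inv_mul_notMem (g : G) (T : Finset G) :
    (T.filter (fun c => g⁻¹ * c ∉ T)).card = escape g T := by
  unfold escape
  have h1 := Finset.card_filter_add_card_filter_not (s := T) (fun c => g⁻¹ * c ∈ T)
  have h2 := Finset.card_filter_add_card_filter_not (s := T) (fun c => g * c ∈ T)
  have h3 : (T.filter (fun c => g⁻¹ * c ∈ T)).card = (T.filter (fun c => g * c ∈ T)).card := by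
    refine Finset.card_bij (fun c _ => g⁻¹ * c) ?_ ?_ ?_
    · intro c hc
      simp only [Finset.mem_filter] at hc ⊢
      exact ⟨hc.2, by simpa using hc.1⟩
    · intro a _ b _ h
      simpa using h
    · intro c hc
      simp only [Finset.mem_filter] at hc
      exact ⟨g * c, by simp [hc.1, hc.2], by simp⟩
  omega

/-- A point of `E \ T` moved out by `g` either leaves `E` or enters `T`; in the second case its
image is a point of `T` that `g⁻¹` moves out of `T`. -/
theorem escape_sdiff_le (g : G) (E T : Finset G) :
    escape g (E \ T) ≤ escape g E + escape g T := by
  rw [← card_filter_inv_mul_notMem g T]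
  unfold escape
  refine le_trans (Finset.card_le_card
    (t := E.filter (fun c => g * c ∉ E) ∪ (T.filter (fun c => g⁻¹ * c ∉ T)).image (g⁻¹ * ·)) ?_)
    (le_trans (Finset.card_union_le _ _) (Nat.add_le_add_left Finset.card_image_le _))
  intro c hc
  simp only [Finset.mem_filter, Finset.mem_union, Finset.mem_sdiff, Finset.mem_image] at hc ⊢
  by_cases h : g * c ∈ E
  · have hT : g * c ∈ T := by tauto
    exact Or.inr ⟨g * c, ⟨hT, by simpa using hc.1.2⟩, by simp⟩
  · exact Or.inl ⟨hc.1.1, h⟩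

/-- Most translates `F c`, `c ∈ E`, of `F` stay inside a sufficiently invariant `E`. -/
theorem card_le_card_filter_translate_add (F E : Finset G) {η : ℝ}
    (h : ∀ g ∈ F, (escape g E : ℝ) ≤ η) :
    (E.card : ℝ) ≤ (E.filter (fun c => F.image (· * c) ⊆ E)).card + F.card * η := by
  have h1 := Finset.card_filter_add_card_filter_not (s := E) (fun c => F.image (· * c) ⊆ E)
  have h2 : (E.filter (fun c => ¬ F.image (· * c) ⊆ E)).card ≤ ∑ g ∈ F, escape g E := by
    refine le_trans (Finset.card_le_card (t := F.biUnion fun g => E.filter (fun c => g * c ∉ E)) ?_)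
      Finset.card_biUnion_le
    intro c hc
    simp only [Finset.mem_filter, Finset.image_subset_iff, not_forall] at hc
    obtain ⟨hcE, g, hg, hgc⟩ := hc
    simp only [Finset.mem_biUnion, Finset.mem_filter]
    exact ⟨g, hg, hcE, hgc⟩
  have h3 : ((∑ g ∈ F, escape g E : ℕ) : ℝ) ≤ F.card * η := by
    push_cast
    simpa using Finset.sum_le_card_nsmul F (fun g => (escape g E : ℝ)) η h
  have h4 : ((E.filter (fun c => ¬ F.image (· * c) ⊆ E)).card : ℝ) ≤ F.card * η :=
    le_trans (by exact_mod_cast h2) h3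
  rw [← h1]
  push_cast
  linarith

/-- Double counting: the translates `F c`, `c ∈ C`, meet `T` at most `|F| |T|` times in total. -/
theorem sum_card_translate_inter_le (F C T : Finset G) :
    ∑ c ∈ C, (F.image (· * c) ∩ T).card ≤ F.card * T.card := by
  calc ∑ c ∈ C, (F.image (· * c) ∩ T).card
      ≤ ∑ c ∈ C, ∑ g ∈ F, (if g * c ∈ T then 1 else 0) := by
        refine Finset.sum_le_sum fun c _ => ?_
        rw [← Finset.card_filter]
        refine le_trans (Finset.card_le_card (t := (F.filter (fun g => g * c ∈ T)).image (· * c)) ?_)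
          Finset.card_image_le
        intro x hx
        simp only [Finset.mem_inter, Finset.mem_image, Finset.mem_filter] at hx ⊢
        obtain ⟨⟨a, ha, rfl⟩, hT⟩ := hx
        exact ⟨a, ⟨ha, hT⟩, rfl⟩
    _ = ∑ g ∈ F, ∑ c ∈ C, (if g * c ∈ T then 1 else 0) := Finset.sum_comm
    _ ≤ ∑ _g ∈ F, T.card := by
        refine Finset.sum_le_sum fun g _ => ?_
        rw [← Finset.card_filter]
        refine Finset.card_le_card_of_injOn (fun c => g * c) ?_ (fun a _ b _ h => by simpa using h)
        intro c hc
        simp only [Finset.coe_filter, Set.mem_ofPred_eq] at hc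
        exact hc.2
    _ = F.card * T.card := by simp

/-- All sufficiently left-invariant finite sets `E` satisfy `h E ≤ t |E|`. -/
def EventuallyLe (h : Finset G → ℝ) (t : ℝ) : Prop :=
  ∃ (K : Finset G) (η : ℝ), 0 < η ∧ ∀ E : Finset G, E.Nonempty →
    (∀ g ∈ K, (escape g E : ℝ) ≤ η * E.card) → h E ≤ t * E.card

theorem EventuallyLe.mono {h : Finset G → ℝ} {s t : ℝ} (hs : EventuallyLe h s) (hst : s ≤ t) :
    EventuallyLe h t := by
  obtain ⟨K, η, hη, H⟩ := hs
  exact ⟨K, η, hη, fun E hE hK => (H E hE hK).trans (by gcongr)⟩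

/-- A greedily chosen almost disjoint union of translates of `F` inside `E`. -/
theorem exists_greedy_union {h : Finset G → ℝ} (h_empty : h ∅ ≤ 0)
    (h_union : ∀ S T, h (S ∪ T) ≤ h S + h T) (h_inv : ∀ S c, h (S.image (· * c)) ≤ h S)
    {θ ε η : ℝ} (hε : ε < 1) {F K E : Finset G} (hF : F.Nonempty)
    (hFθ : h F ≤ θ * F.card) (hFK : ∀ g ∈ K, (escape g F : ℝ) ≤ η * F.card) :
    ∃ T ⊆ E, (∃ k : ℕ, h T ≤ k * (θ * F.card) ∧ (∀ g ∈ K, (escape g T : ℝ) ≤ k * (η * F.card)) ∧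
        (1 - ε) * F.card * k ≤ T.card) ∧
      ∀ c, F.image (· * c) ⊆ E → ε * F.card ≤ (F.image (· * c) ∩ T).card := by
  classical
  let P : Finset G → Prop := fun T => ∃ k : ℕ, h T ≤ k * (θ * F.card) ∧
    (∀ g ∈ K, (escape g T : ℝ) ≤ k * (η * F.card)) ∧ (1 - ε) * F.card * k ≤ T.card
  have hP : P ∅ := ⟨0, by simpa using h_empty, by simp [escape], by simp⟩
  obtain ⟨T, hT, hmax⟩ := Finset.exists_max_image (E.powerset.filter P) Finset.card
    ⟨∅, by simp [hP]⟩
  simp only [Finset.mem_filter, Finset.mem_powerset] at hT hmax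
  refine ⟨T, hT.1, hT.2, fun c hc => ?_⟩
  -- A translate meeting `T` in fewer than `ε |F|` points could be added: it contributes more than
  -- `(1 - ε) |F|` new points, so `P` persists with `k + 1` and maximality of `|T|` fails.
  by_contra! hlt
  have hcard : (F.image (· * c)).card = F.card :=
    Finset.card_image_of_injective _ (mul_left_injective c)
  have hFpos : (0 : ℝ) < F.card := by exact_mod_cast hF.card_pos
  have hadd := Finset.card_union_add_card_inter T (F.image (· * c))
  rw [hcard, Finset.inter_comm] at hadd
  have hadd' : ((T ∪ F.image (· * c)).card : ℝ) + (F.image (· * c) ∩ T).card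
      = T.card + F.card := by exact_mod_cast hadd
  obtain ⟨k, hk1, hk2, hk3⟩ := hT.2
  have hP' : P (T ∪ F.image (· * c)) := by
    refine ⟨k + 1, ?_, fun g hg => ?_, ?_⟩
    · have := h_union T (F.image (· * c))
      have := h_inv F c
      push_cast
      linarith
    · have h1 : (escape g (T ∪ F.image (· * c)) : ℝ) ≤ escape g T + escape g F := by
        exact_mod_cast (escape_union_le _ _ _).trans
          (Nat.add_le_add_left (escape_image_mul_right_le g c F) _)
      have := hk2 g hg
      have := hFK g hg
      push_cast
      linarith
    · push_cast
      linarith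
  have := hmax _ ⟨Finset.union_subset hT.1 hc, hP'⟩
  have : ((T ∪ F.image (· * c)).card : ℝ) ≤ T.card := by exact_mod_cast this
  nlinarith

/-- Put `s = θ' + C δ`. Inside an invariant `E`, the greedy union `T` of translates of `F` fills a
proportion at least `ε / 2` and costs at most `s |T|`; the remainder costs at most `t` per point if
it is still invariant. Hence the gap `t - s` shrinks by the factor `1 - ε / 2`. -/
theorem EventuallyLe.improve {h : Finset G → ℝ} {C : ℝ} (hC : 0 ≤ C)
    (h_le : ∀ E, h E ≤ C * E.card)
    (h_union : ∀ S T, h (S ∪ T) ≤ h S + h T) (h_inv : ∀ S c, h (S.image (· * c)) ≤ h S)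
    {θ θ' ε δ t : ℝ} (hε : 0 < ε) (hε1 : ε < 1) (hδ : 0 < δ) (hθ : 0 ≤ θ) (hθ' : θ ≤ θ' * (1 - ε))
    (hF : ∀ (K : Finset G) (η : ℝ), 0 < η → ∃ F : Finset G, F.Nonempty ∧ h F ≤ θ * F.card ∧
      ∀ g ∈ K, (escape g F : ℝ) ≤ η * F.card)
    (ht : EventuallyLe h t) (hθt : θ' + C * δ ≤ t) :
    EventuallyLe h (t - ε / 2 * (t - (θ' + C * δ))) := by
  obtain ⟨K, η, hη, H⟩ := ht
  -- The factor `1 - ε` absorbs the overlaps of the translates, so `T` is `η δ / 2`-invariant.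
  -- Together with the same tolerance for `E`, this makes `E \ T` `η`-invariant once `|E \ T| > δ
  -- |E|`.
  obtain ⟨F, hFne, hFθ, hFK⟩ := hF K (η * δ / 2 * (1 - ε)) (by
    have : 0 < 1 - ε := by linarith
    positivity)
  have hFpos : (0 : ℝ) < F.card := by exact_mod_cast hFne.card_pos
  have h1ε : 0 < 1 - ε := by linarith
  -- The tolerance `1 / (2 |F|)` ensures that at least half of the `c ∈ E` satisfy `F c ⊆ E`.
  refine ⟨K ∪ F, min (η * δ / 2) (1 / (2 * F.card)), by positivity, fun E hE hinv => ?_⟩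
  have hEpos : (0 : ℝ) < E.card := by exact_mod_cast hE.card_pos
  have h_empty : h ∅ ≤ 0 := by simpa using h_le ∅
  obtain ⟨T, hTE, ⟨k, hk1, hk2, hk3⟩, hT⟩ :=
    exists_greedy_union (E := E) h_empty h_union h_inv hε1 hFne hFθ hFK
  have hTlarge : ε / 2 * E.card ≤ T.card := by
    have h1 := card_le_card_filter_translate_add F E (η := 1 / (2 * F.card) * E.card)
      (fun g hg => (hinv g (Finset.mem_union_right _ hg)).trans (by gcongr; exact min_le_right _ _))
    have h2 : (F.card : ℝ) * (1 / (2 * F.card) * E.card) = E.card / 2 := by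
      field_simp
    have h3 := sum_card_translate_inter_le F (E.filter (fun c => F.image (· * c) ⊆ E)) T
    have h4 := Finset.card_nsmul_le_sum (E.filter (fun c => F.image (· * c) ⊆ E))
      (fun c => ((F.image (· * c) ∩ T).card : ℝ)) (ε * F.card)
      (fun c hc => hT c (Finset.mem_filter.1 hc).2)
    have h5 : (∑ c ∈ E.filter (fun c => F.image (· * c) ⊆ E),
        ((F.image (· * c) ∩ T).card : ℝ)) ≤ F.card * T.card := by exact_mod_cast h3
    rw [nsmul_eq_mul] at h4
    have h6 : ε * (E.filter (fun c => F.image (· * c) ⊆ E)).card ≤ T.card := by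
      refine le_of_mul_le_mul_left ?_ hFpos
      linarith
    rw [h2] at h1
    nlinarith
  have hsplit : (E.card : ℝ) = T.card + (E \ T).card := by
    have := Finset.card_sdiff_add_card_eq_card hTE
    exact_mod_cast (by omega : E.card = T.card + (E \ T).card)
  have hE' : h E ≤ h T + h (E \ T) := by
    have := h_union T (E \ T)
    rwa [Finset.union_sdiff_of_subset hTE] at this
  have hTθ : h T ≤ θ' * T.card := by
    have hθ'0 : 0 ≤ θ' := by
      by_contra! hneg
      nlinarith
    calc h T ≤ k * (θ * F.card) := hk1
      _ ≤ k * (θ' * (1 - ε) * F.card) := by gcongr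
      _ = θ' * ((1 - ε) * F.card * k) := by ring
      _ ≤ _ := by gcongr
  have hCδ : 0 ≤ C * δ := by positivity
  have hT0 : (0 : ℝ) ≤ T.card := by positivity
  have hθ'' : h T ≤ (θ' + C * δ) * T.card := by nlinarith
  have hgap : 0 ≤ t - (θ' + C * δ) := by linarith
  by_cases hsmall : ((E \ T).card : ℝ) ≤ δ * E.card
  · have h1 := h_le (E \ T)
    have hθ'0 : 0 ≤ θ' := by
      by_contra! hneg
      nlinarith
    have h2 : C * (E \ T).card ≤ C * (δ * E.card) := by gcongr
    have h3 : θ' * T.card ≤ θ' * E.card := by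
      gcongr
    have h4 : h E ≤ (θ' + C * δ) * E.card := by linarith
    have h5 : θ' + C * δ ≤ t - ε / 2 * (t - (θ' + C * δ)) := by nlinarith
    exact h4.trans (by gcongr)
  · push Not at hsmall
    have hne : (E \ T).Nonempty := by
      rw [← Finset.card_pos]
      have : (0 : ℝ) < (E \ T).card := lt_of_le_of_lt (by positivity) hsmall
      exact_mod_cast this
    have h1 := H (E \ T) hne (fun g hg => by
      have h1 : (escape g (E \ T) : ℝ) ≤ escape g E + escape g T := by
        exact_mod_cast escape_sdiff_le g E T
      have h2 : (escape g E : ℝ) ≤ η * δ / 2 * E.card :=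
        (hinv g (Finset.mem_union_left _ hg)).trans (by gcongr; exact min_le_left _ _)
      have h3 : (escape g T : ℝ) ≤ η * δ / 2 * T.card :=
        (hk2 g hg).trans (by
          calc (k : ℝ) * (η * δ / 2 * (1 - ε) * F.card)
              = η * δ / 2 * ((1 - ε) * F.card * k) := by ring
            _ ≤ _ := by gcongr)
      have h4 : η * δ / 2 * T.card ≤ η * δ / 2 * E.card := by
        gcongr
      have h5 : η * (δ * E.card) ≤ η * (E \ T).card := by gcongr
      linarith)
    have h2 : (t - (θ' + C * δ)) * (ε / 2 * E.card) ≤ (t - (θ' + C * δ)) * T.card := by gcongr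
    have h3 : ((E \ T).card : ℝ) = E.card - T.card := by linarith
    rw [h3] at h1
    nlinarith

/-- Ornstein–Weiss: a subadditive invariant function that is at most `θ |F|` on arbitrarily
invariant sets `F` is at most `t |E|` on all sufficiently invariant sets `E`, for every `t > θ`. -/
theorem eventuallyLe_of_subadditive {h : Finset G → ℝ} {C : ℝ} (hC : 0 ≤ C)
    (h_le : ∀ E, h E ≤ C * E.card)
    (h_union : ∀ S T, h (S ∪ T) ≤ h S + h T) (h_inv : ∀ S c, h (S.image (· * c)) ≤ h S)
    {θ t : ℝ} (hθ : 0 ≤ θ) (hθt : θ < t)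
    (hF : ∀ (K : Finset G) (η : ℝ), 0 < η → ∃ F : Finset G, F.Nonempty ∧ h F ≤ θ * F.card ∧
      ∀ g ∈ K, (escape g F : ℝ) ≤ η * F.card) :
    EventuallyLe h t := by
  obtain ⟨θ', hθ1, hθ2⟩ := exists_between hθt
  have hθ'pos : 0 < θ' := by linarith
  obtain ⟨ε, hε, hε1, hθε⟩ : ∃ ε : ℝ, 0 < ε ∧ ε < 1 ∧ θ ≤ θ' * (1 - ε) := by
    refine ⟨(θ' - θ) / (2 * θ'), div_pos (by linarith) (by linarith), ?_, ?_⟩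
    · rw [div_lt_one (by linarith)]
      linarith
    · have : θ' * (1 - (θ' - θ) / (2 * θ')) = (θ' + θ) / 2 := by
        field_simp
        ring
      rw [this]
      linarith
  obtain ⟨δ, hδ, hδt⟩ : ∃ δ : ℝ, 0 < δ ∧ θ' + C * δ < t := by
    refine ⟨(t - θ') / (2 * (C + 1)), div_pos (by linarith) (by linarith), ?_⟩
    have h1 : C * ((t - θ') / (2 * (C + 1))) = (t - θ') / 2 * (C / (C + 1)) := by
      field_simp
    have h2 : C / (C + 1) ≤ 1 := by
      rw [div_le_one (by linarith)]
      linarith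
    have h3 : 0 < (t - θ') / 2 := by linarith
    rw [h1]
    nlinarith
  set s := θ' + C * δ with hs
  have hs0 : s ≤ max C s := le_max_right _ _
  -- Starting from the trivial bound `C`, each use of `improve` contracts the gap to `s < t`
  -- geometrically.
  have key : ∀ k : ℕ, EventuallyLe h (s + (1 - ε / 2) ^ k * (max C s - s)) := by
    intro k
    induction k with
    | zero =>
      refine ⟨∅, 1, one_pos, fun E _ _ => (h_le E).trans ?_⟩
      gcongr
      simp
    | succ k ih =>
      have h0 : 0 ≤ (1 - ε / 2) ^ k * (max C s - s) :=
        mul_nonneg (pow_nonneg (by linarith) _) (by linarith)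
      have := ih.improve hC h_le h_union h_inv hε hε1 hδ hθ hθε hF (by linarith)
      refine this.mono (le_of_eq ?_)
      rw [← hs, pow_succ]
      ring
  have hlim : Tendsto (fun k : ℕ => s + (1 - ε / 2) ^ k * (max C s - s)) atTop
      (𝓝 (s + 0 * (max C s - s))) :=
    ((tendsto_pow_atTop_nhds_zero_of_lt_one (by linarith) (by linarith)).mul_const _).const_add _
  obtain ⟨k, hk⟩ := (hlim.eventually_lt_const (by linarith : s + 0 * (max C s - s) < t)).exists
  exact (key k).mono hk.le

theorem IsFolnerSeq.eventually_escape_le {F : ℕ → Finset G} (hF : IsFolnerSeq F)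
    (K : Finset G) {η : ℝ} (hη : 0 < η) :
    ∀ᶠ n in atTop, ∀ g ∈ K, (escape g (F n) : ℝ) ≤ η * (F n).card := by
  rw [Filter.eventually_all_finset]
  intro g _
  filter_upwards [(hF.tendsto g).eventually_lt_const hη] with n hn
  have hpos : (0 : ℝ) < (F n).card := by
    exact_mod_cast Finset.card_pos.2 ⟨1, hF.one_mem n⟩
  rw [div_lt_iff₀ hpos] at hn
  refine le_trans ?_ hn.le
  have : escape g (F n) ≤ ((g • (F n : Set G)) ∆ (F n : Set G)).ncard := by
    unfold escape
    rw [← Set.ncard_coe_finset]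
    refine Set.ncard_le_ncard_of_injOn (fun c => g * c) ?_ (fun a _ b _ h => by simpa using h) ?_
    · intro c hc
      simp only [Finset.coe_filter, Set.mem_ofPred_eq] at hc
      exact Or.inl ⟨Set.smul_mem_smul_set (by simpa using hc.1), by simpa using hc.2⟩
    · exact ((F n).finite_toSet.smul_set).symmDiff (F n).finite_toSet
  exact_mod_cast this

end OrnsteinWeiss

/-! ### Subadditivity of the order of orbit joins -/

section CoverDim

theorem card_filter_lt_mono {γ : Type*} [LinearOrder γ] (A : Finset γ) {a b : γ} (hab : a ≤ b) :
    (A.filter (· < a)).card ≤ (A.filter (· < b)).card :=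
  Finset.card_le_card (Finset.monotone_filter_right _ fun _ _ hx => lt_of_lt_of_le hx hab)

theorem card_filter_lt_strictMono {γ : Type*} [LinearOrder γ] (A : Finset γ) {a b : γ}
    (ha : a ∈ A) (hab : a < b) : (A.filter (· < a)).card < (A.filter (· < b)).card := by
  refine Finset.card_lt_card (Finset.ssubset_iff_of_subset
    (Finset.monotone_filter_right _ fun x _ hx => lt_trans hx hab) |>.2 ⟨a, ?_, ?_⟩)
  · simp [ha, hab]
  · simp

/-- A chain in a product of two finite linear orders has at most `|S| + |T| - 1` elements. -/
theorem card_le_of_chain {α β : Type*} [LinearOrder α] [LinearOrder β] {S : Finset α}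
    {T : Finset β} {R : Finset (α × β)} (hR : R ⊆ S ×ˢ T)
    (hchain : ∀ p ∈ R, ∀ q ∈ R, p.1 < q.1 → p.2 ≤ q.2) :
    R.card ≤ S.card + T.card - 1 := by
  -- The rank is injective on the chain and is at most `(|S| - 1) + (|T| - 1)`.
  let rk : α × β → ℕ := fun p => (S.filter (· < p.1)).card + (T.filter (· < p.2)).card
  have hS : ∀ p ∈ R, p.1 ∈ S := fun p hp => (Finset.mem_product.1 (hR hp)).1
  have hT : ∀ p ∈ R, p.2 ∈ T := fun p hp => (Finset.mem_product.1 (hR hp)).2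
  have hlt : ∀ p ∈ R, ∀ q ∈ R, p.1 < q.1 → rk p < rk q := fun p hp q hq h =>
    add_lt_add_of_lt_of_le (card_filter_lt_strictMono S (hS p hp) h) (card_filter_lt_mono T (hchain p hp q hq h))
  have hinj : Set.InjOn rk R := by
    intro p hp q hq h
    rcases lt_trichotomy p.1 q.1 with h1 | h1 | h1
    · exact absurd h (hlt p hp q hq h1).ne
    · rcases lt_trichotomy p.2 q.2 with h2 | h2 | h2
      · exact absurd h (add_lt_add_of_le_of_lt (card_filter_lt_mono S h1.le) (card_filter_lt_strictMono T (hT p hp) h2)).ne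
      · exact Prod.ext h1 h2
      · exact absurd h (add_lt_add_of_le_of_lt (card_filter_lt_mono S h1.ge) (card_filter_lt_strictMono T (hT q hq) h2)).ne'
    · exact absurd h (hlt q hq p hp h1).ne'
  have hcard : R.card ≤ (Finset.range (S.card + T.card - 1)).card := by
    refine Finset.card_le_card_of_injOn rk ?_ hinj
    intro p hp
    have h1 : (S.filter (· < p.1)).card < S.card := Finset.card_lt_card
      (Finset.filter_ssubset.2 ⟨p.1, hS p hp, lt_irrefl _⟩)
    have h2 : (T.filter (· < p.2)).card < T.card := Finset.card_lt_card
      (Finset.filter_ssubset.2 ⟨p.2, hT p hp, lt_irrefl _⟩)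
    simp only [Finset.coe_range, Set.mem_Iio, rk]
    omega
  simpa using hcard

/-- `𝒰` is refined by a finite cover of order at most `k` by the cozero sets of nonnegative
continuous functions. -/
def HasOrderLe {X : Type*} [TopologicalSpace X] (𝒰 : Set (Set X)) (k : ℕ) : Prop :=
  ∃ (n : ℕ) (w : Fin n → C(X, ℝ)), (∀ i x, 0 ≤ w i x) ∧ (∀ x, ∃ i, 0 < w i x) ∧
    (∀ i, ∃ U ∈ 𝒰, {x | 0 < w i x} ⊆ U) ∧
    ∀ x, (Finset.univ.filter (fun i => 0 < w i x)).card ≤ k + 1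

theorem HasOrderLe.of_fintype {X ι : Type*} [TopologicalSpace X] [Fintype ι] {𝒰 : Set (Set X)}
    {k : ℕ} (w : ι → C(X, ℝ)) (h0 : ∀ i x, 0 ≤ w i x) (hpos : ∀ x, ∃ i, 0 < w i x)
    (hU : ∀ i, ∃ U ∈ 𝒰, {x | 0 < w i x} ⊆ U)
    (hcard : ∀ x, (Finset.univ.filter (fun i => 0 < w i x)).card ≤ k + 1) : HasOrderLe 𝒰 k := by
  let e := Fintype.equivFin ι
  refine ⟨Fintype.card ι, fun i => w (e.symm i), fun i x => h0 _ x, fun x => ?_, fun i => hU _,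
    fun x => le_trans (le_of_eq ?_) (hcard x)⟩
  · obtain ⟨i, hi⟩ := hpos x
    exact ⟨e i, by simpa using hi⟩
  · refine Finset.card_equiv e.symm (fun i => by simp)

theorem HasOrderLe.comp {X Z : Type*} [TopologicalSpace X] [TopologicalSpace Z]
    {𝒰 : Set (Set X)} {𝒱 : Set (Set Z)} {k : ℕ} (h : HasOrderLe 𝒰 k) (f : C(Z, X))
    (hf : ∀ U ∈ 𝒰, ∃ V ∈ 𝒱, f ⁻¹' U ⊆ V) : HasOrderLe 𝒱 k := by
  obtain ⟨n, w, h0, hpos, hU, hcard⟩ := h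
  refine ⟨n, fun i => (w i).comp f, fun i x => h0 i _, fun x => hpos _, fun i => ?_,
    fun x => hcard _⟩
  obtain ⟨U, hU1, hU2⟩ := hU i
  obtain ⟨V, hV1, hV2⟩ := hf U hU1
  exact ⟨V, hV1, fun x hx => hV2 (hU2 hx)⟩

theorem sum_Iio_add_le {q : ℕ} (u : Fin q → ℝ) (hu : ∀ i, 0 ≤ u i) {i i' : Fin q} (hi : i < i') :
    ∑ j ∈ Finset.Iio i, u j + u i ≤ ∑ j ∈ Finset.Iio i', u j := by
  rw [add_comm, ← Finset.sum_insert (by simp : i ∉ Finset.Iio i)]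
  refine Finset.sum_le_sum_of_subset_of_nonneg (fun j hj => ?_) fun j _ _ => hu j
  simp only [Finset.mem_insert, Finset.mem_Iio] at hj ⊢
  rcases hj with rfl | hj
  · exact hi
  · exact hj.trans hi

/-- Order is subadditive under joins: cutting `[0, ∞)` at the partial sums of both families
of functions and intersecting the resulting intervals gives a cover of the right order. -/
theorem HasOrderLe.join {X : Type*} [TopologicalSpace X] {𝒰 𝒱 𝒲 : Set (Set X)} {k l : ℕ}
    (h : HasOrderLe 𝒰 k) (h' : HasOrderLe 𝒱 l)
    (hW : ∀ U ∈ 𝒰, ∀ V ∈ 𝒱, ∃ W ∈ 𝒲, U ∩ V ⊆ W) : HasOrderLe 𝒲 (k + l) := by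
  obtain ⟨n, w, h0, hpos, hU, hcard⟩ := h
  obtain ⟨m, v, h0', hpos', hV, hcard'⟩ := h'
  let A : Fin n → C(X, ℝ) := fun i => ∑ j ∈ Finset.Iio i, w j
  let B : Fin m → C(X, ℝ) := fun i => ∑ j ∈ Finset.Iio i, v j
  have hA : ∀ i x, A i x = ∑ j ∈ Finset.Iio i, w j x := fun i x => by simp [A]
  have hB : ∀ i x, B i x = ∑ j ∈ Finset.Iio i, v j x := fun i x => by simp [B]
  have hAmono : ∀ i i' x, i < i' → A i x + w i x ≤ A i' x := fun i i' x hi => by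
    rw [hA, hA]
    exact sum_Iio_add_le (fun j => w j x) (fun j => h0 j x) hi
  have hBmono : ∀ i i' x, i < i' → B i x + v i x ≤ B i' x := fun i i' x hi => by
    rw [hB, hB]
    exact sum_Iio_add_le (fun j => v j x) (fun j => h0' j x) hi
  -- `c (i, j)` is the length of the overlap of `(A i, A i + w i)` and `(B j, B j + v j)`.
  let c : Fin n × Fin m → C(X, ℝ) := fun p =>
    ⟨fun x => max 0 (min (A p.1 x + w p.1 x) (B p.2 x + v p.2 x) - max (A p.1 x) (B p.2 x)),
      by fun_prop⟩
  have hc : ∀ p x, 0 < c p x ↔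
      max (A p.1 x) (B p.2 x) < min (A p.1 x + w p.1 x) (B p.2 x + v p.2 x) := by
    intro p x
    simp only [c, ContinuousMap.coe_mk, lt_max_iff, lt_irrefl, false_or, sub_pos]
  have hcw : ∀ p x, 0 < c p x → 0 < w p.1 x ∧ 0 < v p.2 x := by
    intro p x hp
    rw [hc, max_lt_iff, lt_min_iff, lt_min_iff] at hp
    constructor <;> linarith [hp.1.1, hp.2.2]
  refine HasOrderLe.of_fintype c (fun p x => le_max_left _ _) (fun x => ?_) (fun p => ?_)
    (fun x => ?_)
  -- The first nondegenerate intervals of the two families both start at `0`, so they overlap.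
  · have hmin : ∀ {q : ℕ} (u : Fin q → ℝ), (∀ i, 0 ≤ u i) → (∃ i, 0 < u i) →
        ∃ i, 0 < u i ∧ ∑ j ∈ Finset.Iio i, u j = 0 := by
      intro q u hu ⟨i, hi⟩
      obtain ⟨j, hj, hjmin⟩ := Finset.exists_min_image (Finset.univ.filter (fun i => 0 < u i)) id
        ⟨i, by simpa using hi⟩
      refine ⟨j, by simpa using hj, Finset.sum_eq_zero fun a ha => ?_⟩
      by_contra hne
      have := hjmin a (by simpa using lt_of_le_of_ne (hu a) (Ne.symm hne))
      exact absurd (Finset.mem_Iio.1 ha) (not_lt.2 this)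
    obtain ⟨i, hi, hi0⟩ := hmin (fun i => w i x) (fun i => h0 i x) (hpos x)
    obtain ⟨j, hj, hj0⟩ := hmin (fun i => v i x) (fun i => h0' i x) (hpos' x)
    refine ⟨(i, j), ?_⟩
    rw [hc]
    simp only [hA, hB, hi0, hj0]
    simp [hi, hj]
  · obtain ⟨U, hU1, hU2⟩ := hU p.1
    obtain ⟨V, hV1, hV2⟩ := hV p.2
    obtain ⟨W, hW1, hW2⟩ := hW U hU1 V hV1
    exact ⟨W, hW1, fun x hx => hW2 ⟨hU2 (hcw p x hx).1, hV2 (hcw p x hx).2⟩⟩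
  -- Both families of intervals are ordered along the line, so overlapping pairs form a chain, of
  -- size at most `(k + 1) + (l + 1) - 1`.
  · have := card_le_of_chain (S := Finset.univ.filter (fun i => 0 < w i x))
      (T := Finset.univ.filter (fun i => 0 < v i x))
      (R := Finset.univ.filter (fun p => 0 < c p x))
      (fun p hp => by
        have := hcw p x (by simpa using hp)
        simpa using this)
      (fun p hp q hq hpq => by
        have hp' : 0 < c p x := by simpa using hp
        have hq' : 0 < c q x := by simpa using hq
        rw [hc, max_lt_iff, lt_min_iff, lt_min_iff] at hp' hq'
        by_contra! hlt
        have h1 := hBmono _ _ x hlt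
        have h2 := hAmono _ _ x hpq
        linarith [hp'.2.1, hq'.1.2])
    have h1 := hcard x
    have h2 := hcard' x
    omega

theorem ord_le_iff {X : Type*} {𝒱 : Set (Set X)} {k : ℕ} :
    ord 𝒱 ≤ k ↔ ∀ x : X, {O ∈ 𝒱 | x ∈ O}.encard ≤ (k + 1 : ℕ) := by
  unfold ord
  rw [tsub_le_iff_right, iSup_le_iff]
  simp

/-- Every open subset of a metric space is the cozero set of a nonnegative continuous function. -/
theorem exists_continuousMap_pos_iff {X : Type*} [MetricSpace X] {U : Set X} (hU : IsOpen U) :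
    ∃ w : C(X, ℝ), (∀ x, 0 ≤ w x) ∧ ∀ x, 0 < w x ↔ x ∈ U := by
  rcases Set.eq_empty_or_nonempty Uᶜ with h | h
  · have : U = univ := compl_empty_iff.1 h
    exact ⟨1, by simp, by simp [this]⟩
  · refine ⟨⟨fun x => Metric.infDist x Uᶜ, Metric.continuous_infDist_pt _⟩,
      fun x => Metric.infDist_nonneg, fun x => ?_⟩
    have := hU.isClosed_compl.notMem_iff_infDist_pos h (x := x)
    simp only [ContinuousMap.coe_mk, ← this, Set.notMem_compl_iff]

/-- Open sets of a metric space are cozero sets, so covers may be traded for families of functions.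
Conversely, indices with equal cozero sets merge, which only lowers the multiplicity. -/
theorem coverDim_le_iff {X : Type*} [MetricSpace X] {𝒰 : Set (Set X)} {k : ℕ} :
    coverDim 𝒰 ≤ k ↔ HasOrderLe 𝒰 k := by
  constructor
  · intro h
    obtain ⟨𝒱, h𝒱, hR, hord⟩ :
        ∃ 𝒱 : Set (Set X), IsFinOpenCover 𝒱 ∧ Refines 𝒱 𝒰 ∧ ord 𝒱 ≤ k := by
      by_contra! hne
      have : ((k : ℕ∞) + 1) ≤ coverDim 𝒰 :=
        le_iInf₂ fun 𝒱 h => Order.add_one_le_of_lt (hne 𝒱 h.1 h.2)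
      have h2 := this.trans h
      exact absurd h2 (by exact_mod_cast (Nat.not_succ_le_self k))
    rw [ord_le_iff] at hord
    have : Fintype 𝒱 := h𝒱.finite.fintype
    choose w hw0 hw using fun V : 𝒱 => exists_continuousMap_pos_iff (h𝒱.isOpen V V.2)
    refine HasOrderLe.of_fintype w hw0 (fun x => ?_) (fun V => ?_) (fun x => ?_)
    · have : x ∈ ⋃₀ 𝒱 := by rw [h𝒱.covers]; trivial
      obtain ⟨V, hV, hx⟩ := this
      exact ⟨⟨V, hV⟩, (hw _ _).2 hx⟩
    · obtain ⟨U, hU, hVU⟩ := hR V V.2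
      exact ⟨U, hU, fun x hx => hVU ((hw V x).1 hx)⟩
    · have h1 := hord x
      have h2 : ((Finset.univ.filter (fun V => 0 < w V x) : Finset 𝒱) : Set 𝒱).encard
          ≤ {O ∈ 𝒱 | x ∈ O}.encard := by
        refine Set.encard_le_encard_of_injOn (f := Subtype.val) ?_ Subtype.val_injective.injOn
        intro V hV
        exact ⟨V.2, (hw V x).1 (by simpa using hV)⟩
      rw [Set.encard_coe_eq_coe_finsetCard] at h2
      exact_mod_cast h2.trans h1
  · rintro ⟨n, w, h0, hpos, hU, hcard⟩
    refine iInf₂_le_of_le (Set.range fun i => {x | 0 < w i x})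
      ⟨⟨Set.finite_range _, ?_, ?_⟩, ?_⟩ ?_
    · rintro _ ⟨i, rfl⟩
      exact isOpen_lt continuous_const (w i).continuous
    · refine Set.eq_univ_of_forall fun x => ?_
      obtain ⟨i, hi⟩ := hpos x
      exact ⟨_, ⟨i, rfl⟩, hi⟩
    · rintro _ ⟨i, rfl⟩
      exact hU i
    · rw [ord_le_iff]
      intro x
      have h1 : {O ∈ Set.range fun i => {x | 0 < w i x} | x ∈ O} ⊆
          (fun i => {x | 0 < w i x}) '' (Finset.univ.filter (fun i => 0 < w i x) : Finset (Fin n)) := by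
        rintro _ ⟨⟨i, rfl⟩, hx⟩
        exact ⟨i, by simpa using hx, rfl⟩
      refine (Set.encard_le_encard h1).trans ((Set.encard_image_le _ _).trans ?_)
      rw [Set.encard_coe_eq_coe_finsetCard]
      exact_mod_cast hcard x

theorem IsFinOpenCover.exists_hasOrderLe {X : Type*} [MetricSpace X] {𝒰 : Set (Set X)}
    (h : IsFinOpenCover 𝒰) : ∃ k, HasOrderLe 𝒰 k := by
  refine ⟨𝒰.ncard, coverDim_le_iff.1 (iInf₂_le_of_le 𝒰 ⟨h, fun V hV => ⟨V, hV, le_rfl⟩⟩ ?_)⟩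
  rw [ord_le_iff]
  intro x
  refine (Set.encard_le_encard (Set.sep_subset _ _)).trans ?_
  rw [← h.finite.cast_ncard_eq]
  exact_mod_cast Nat.le_succ _

section Orbit

theorem HasOrderLe.orbitJoin_singleton {G X : Type*} [Group G] [MetricSpace X] [MulAction G X]
    [ContinuousConstSMul G X] {𝒰 : Set (Set X)}
    {k : ℕ} (h : HasOrderLe 𝒰 k) (g : G) : HasOrderLe (orbitJoin 𝒰 {g}) k := by
  refine h.comp ⟨fun x => g • x, continuous_const_smul g⟩ fun U hU =>
    ⟨_, ⟨fun _ => U, fun _ _ => hU, rfl⟩, ?_⟩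
  simp

theorem hasOrderLe_orbitJoin_empty {G X : Type*} [Group G] [MetricSpace X] [MulAction G X]
    (𝒰 : Set (Set X)) :
    HasOrderLe (orbitJoin 𝒰 (∅ : Finset G)) 0 :=
  ⟨1, fun _ => 1, by simp, by simp, fun _ => ⟨univ, ⟨fun _ => univ, by simp, by simp⟩, by simp⟩,
    by simp⟩

variable {G X : Type*} [Group G] [DecidableEq G] [MetricSpace X] [MulAction G X]

theorem HasOrderLe.orbitJoin_union {𝒰 : Set (Set X)} {A B : Finset G} {k l : ℕ}
    (hA : HasOrderLe (orbitJoin 𝒰 A) k) (hB : HasOrderLe (orbitJoin 𝒰 B) l) :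
    HasOrderLe (orbitJoin 𝒰 (A ∪ B)) (k + l) := by
  refine hA.join hB ?_
  rintro _ ⟨U, hU, rfl⟩ _ ⟨V, hV, rfl⟩
  refine ⟨_, ⟨fun g => if g ∈ A then U g else V g, fun g hg => ?_, rfl⟩, ?_⟩
  · by_cases h : g ∈ A
    · simpa [h] using hU g h
    · simpa [h] using hV g ((Finset.mem_union.1 hg).resolve_left h)
  · rintro x ⟨hx1, hx2⟩
    simp only [Set.mem_iInter, Set.mem_preimage] at hx1 hx2 ⊢
    intro g hg
    by_cases h : g ∈ A
    · simpa [h] using hx1 g h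
    · simpa [h] using hx2 g ((Finset.mem_union.1 hg).resolve_left h)

/-- Pulling back along `x ↦ c • x` turns the join over `A` into the join over `A c`. -/
theorem HasOrderLe.orbitJoin_image_mul_right [ContinuousConstSMul G X] {𝒰 : Set (Set X)}
    {A : Finset G} {k : ℕ} (hA : HasOrderLe (orbitJoin 𝒰 A) k) (c : G) :
    HasOrderLe (orbitJoin 𝒰 (A.image (· * c))) k := by
  refine hA.comp ⟨fun x => c • x, continuous_const_smul c⟩ ?_
  rintro _ ⟨U, hU, rfl⟩
  refine ⟨_, ⟨fun g => U (g * c⁻¹), fun g hg => ?_, rfl⟩, ?_⟩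
  · obtain ⟨a, ha, rfl⟩ := Finset.mem_image.1 hg
    simpa using hU a ha
  · intro x hx
    simp only [Set.mem_iInter, Set.mem_preimage, ContinuousMap.coe_mk] at hx ⊢
    intro g hg
    obtain ⟨a, ha, rfl⟩ := Finset.mem_image.1 hg
    simpa [mul_smul] using hx a ha

theorem HasOrderLe.orbitJoin_card [ContinuousConstSMul G X] {𝒰 : Set (Set X)}
    {k : ℕ} (h : HasOrderLe 𝒰 k) (A : Finset G) : HasOrderLe (orbitJoin 𝒰 A) (k * A.card) := by
  induction A using Finset.induction_on with
  | empty => simpa using hasOrderLe_orbitJoin_empty 𝒰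
  | insert a s ha ih =>
    have := (h.orbitJoin_singleton a).orbitJoin_union ih
    rwa [← Finset.insert_eq, show k + k * s.card = k * (insert a s).card by
      rw [Finset.card_insert_of_notMem ha]; ring] at this

/-- If the mean dimension along the Følner sequence `F` is less than `L / 2`, then every finite
open cover has a long join along any other Følner sequence `F'` that is refined by a cover
of order less than `L |F' n| / 2`. -/
theorem exists_hasOrderLe_orbitJoin [ContinuousConstSMul G X] {F F' : ℕ → Finset G}
    (hF : IsFolnerSeq F) (hF' : IsFolnerSeq F') {L : ℕ} (hL : mdim X F < (L : ℝ≥0∞) / 2)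
    {𝒰 : Set (Set X)} (h𝒰 : IsFinOpenCover 𝒰) :
    ∃ n r, HasOrderLe (orbitJoin 𝒰 (F' n)) r ∧ 2 * r < L * (F' n).card := by
  obtain ⟨C, hC⟩ := h𝒰.exists_hasOrderLe
  -- Nothing is lost by `toNat`: `orbitJoin_card` bounds the value by `C |A|`.
  let hN : Finset G → ℕ := fun A => (coverDim (orbitJoin 𝒰 A)).toNat
  have hcoe : ∀ A : Finset G, ((hN A : ℕ) : ℕ∞) = coverDim (orbitJoin 𝒰 A) := fun A =>
    ENat.natCast_toNat (ne_top_of_le_ne_top (ENat.natCast_ne_top _)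
      (coverDim_le_iff.2 (hC.orbitJoin_card A)))
  have hle : ∀ (A : Finset G) (k : ℕ), hN A ≤ k ↔ HasOrderLe (orbitJoin 𝒰 A) k := by
    intro A k
    rw [← coverDim_le_iff, ← hcoe, Nat.cast_le]
  have hself : ∀ A, HasOrderLe (orbitJoin 𝒰 A) (hN A) := fun A => (hle A _).1 le_rfl
  have hlim : limsup (fun n => ((coverDim (orbitJoin 𝒰 (F n)) : ℕ∞) : ℝ≥0∞) / ((F n).card : ℝ≥0∞))
      atTop < (L : ℝ≥0∞) / 2 :=
    lt_of_le_of_lt (le_iSup₂_of_le 𝒰 h𝒰 le_rfl) hL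
  obtain ⟨θ, hθ1, hθ2⟩ := ENNReal.lt_iff_exists_nnreal_btwn.1 hlim
  have hθL : (θ : ℝ) < L / 2 := by
    have h1 : ((L : ℝ≥0∞) / 2) = (((L : NNReal) / 2 : NNReal) : ℝ≥0∞) := by
      rw [ENNReal.coe_div two_ne_zero]
      simp
    rw [h1, ENNReal.coe_lt_coe] at hθ2
    exact_mod_cast hθ2
  have hev : ∀ᶠ n in atTop, (hN (F n) : ℝ) ≤ θ * (F n).card := by
    filter_upwards [eventually_lt_of_limsup_lt hθ1] with n hn
    have hpos : 0 < (F n).card := Finset.card_pos.2 ⟨1, hF.one_mem n⟩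
    rw [← hcoe] at hn
    have h2 := (ENNReal.div_lt_iff (Or.inl (by exact_mod_cast hpos.ne')) (Or.inl (by simp))).1 hn
    have h3 : ((hN (F n) : NNReal) : ℝ≥0∞) < ((θ * (F n).card : NNReal) : ℝ≥0∞) := by
      simpa using h2
    rw [ENNReal.coe_lt_coe] at h3
    exact_mod_cast h3.le
  obtain ⟨t, ht1, ht2⟩ := exists_between hθL
  obtain ⟨K, η, hη, H⟩ := eventuallyLe_of_subadditive (h := fun A : Finset G => (hN A : ℝ))
    (C := C) (θ := θ) (t := t) (by positivity)
    (fun E => by exact_mod_cast (hle _ _).2 (hC.orbitJoin_card E))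
    (fun S T => by exact_mod_cast (hle _ _).2 ((hself S).orbitJoin_union (hself T)))
    (fun S c => by exact_mod_cast (hle _ _).2 ((hself S).orbitJoin_image_mul_right c))
    (by positivity) ht1 (fun K η hη => by
      obtain ⟨n, hn1, hn2⟩ := (hev.and (hF.eventually_escape_le K hη)).exists
      exact ⟨F n, ⟨1, hF.one_mem n⟩, hn1, hn2⟩)
  obtain ⟨n, hn⟩ := (hF'.eventually_escape_le K hη).exists
  have h1 := H (F' n) ⟨1, hF'.one_mem n⟩ hn
  refine ⟨n, hN (F' n), hself _, ?_⟩
  have hpos : (0 : ℝ) < (F' n).card := by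
    exact_mod_cast Finset.card_pos.2 ⟨1, hF'.one_mem n⟩
  have h2 : (2 * hN (F' n) : ℝ) < L * (F' n).card := by nlinarith
  exact_mod_cast h2

end Orbit

end CoverDim

/-! ### Maps in general position -/

section GeneralPosition

/-- Points of the cube can be moved by at most `δ` inside the cube so that any `N + 1` of them
become affinely independent. -/
theorem exists_perturbation_det_ne_zero {N M : ℕ} (p : Fin M → Fin N → ℝ)
    (hp : ∀ v l, p v l ∈ Icc (0 : ℝ) 1) {δ : ℝ} (hδ : 0 < δ) :
    ∃ q : Fin M → Fin N → ℝ, (∀ v l, q v l ∈ Icc (0 : ℝ) 1) ∧ (∀ v l, |q v l - p v l| ≤ δ) ∧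
      ∀ e : Fin (N + 1) → Fin M, Function.Injective e →
        (Matrix.of fun i => (Fin.cons 1 (q (e i)) : Fin (N + 1) → ℝ)).det ≠ 0 := by
  let τ : Fin M → ℝ := fun v => 1 / ((v : ℝ) + 1)
  have hτ : Function.Injective τ := by
    intro a b h
    simp only [τ, one_div, inv_inj, add_left_inj, Nat.cast_inj] at h
    exact Fin.ext h
  have hτ0 : ∀ v, 0 ≤ τ v := fun v => by positivity
  have hτ1 : ∀ v, τ v ≤ 1 := fun v => by
    simp only [τ]
    rw [div_le_one (by positivity)]
    linarith [(Nat.cast_nonneg (v : ℕ) : (0 : ℝ) ≤ (v : ℕ))]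
  -- Points on the moment curve have nonzero Vandermonde determinants. Hence, on the segment from
  -- `p` to `c`, each determinant is a nonzero polynomial in the parameter, and a small parameter
  -- avoids all roots.
  let c : Fin M → Fin N → ℝ := fun v l => τ v ^ ((l : ℕ) + 1)
  have hc : ∀ v l, c v l ∈ Icc (0 : ℝ) 1 := fun v l =>
    ⟨pow_nonneg (hτ0 v) _, pow_le_one₀ (hτ0 v) (hτ1 v)⟩
  let A : (Fin (N + 1) → Fin M) → Matrix (Fin (N + 1)) (Fin (N + 1)) (Polynomial ℝ) := fun e =>
    Matrix.of fun i => Fin.cons 1 fun l =>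
      Polynomial.C (p (e i) l) + Polynomial.X * Polynomial.C (c (e i) l - p (e i) l)
  have hA : ∀ e s, (A e).det.eval s = (Matrix.of fun i =>
      (Fin.cons 1 (fun l => p (e i) l + s * (c (e i) l - p (e i) l)) : Fin (N + 1) → ℝ)).det := by
    intro e s
    rw [← Polynomial.coe_evalRingHom, RingHom.map_det]
    congr 1
    ext i j
    refine Fin.cases ?_ (fun l => ?_) j <;> simp [A]
  have hA0 : ∀ e, Function.Injective e → (A e).det ≠ 0 := by
    intro e he h0
    have h1 := hA e 1
    rw [h0, Polynomial.eval_zero] at h1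
    have h2 : (Matrix.of fun i =>
        (Fin.cons 1 (fun l => p (e i) l + 1 * (c (e i) l - p (e i) l)) : Fin (N + 1) → ℝ))
        = Matrix.vandermonde (fun i => τ (e i)) := by
      ext i j
      refine Fin.cases ?_ (fun l => ?_) j <;> simp [Matrix.vandermonde, c]
    rw [h2] at h1
    exact Matrix.det_vandermonde_ne_zero_iff.2 (hτ.comp he) h1.symm
  classical
  let P : Polynomial ℝ := ∏ e ∈ Finset.univ.filter (fun e : Fin (N + 1) → Fin M =>
    Function.Injective e), (A e).det
  have hP : P ≠ 0 := Finset.prod_ne_zero_iff.2 fun e he => hA0 e (by simpa using he)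
  obtain ⟨s, hs, hsP⟩ := ((Set.Ioo_infinite (lt_min hδ one_pos)).sdiff
    (P.roots.toFinset.finite_toSet)).nonempty
  have hs0 : 0 ≤ s := hs.1.le
  have hsδ : s ≤ δ := hs.2.le.trans (min_le_left _ _)
  have hs1 : s ≤ 1 := hs.2.le.trans (min_le_right _ _)
  refine ⟨fun v l => p v l + s * (c v l - p v l), fun v l => ?_, fun v l => ?_, fun e he h => ?_⟩
  · have h1 := hp v l
    have h2 := hc v l
    constructor <;> nlinarith [h1.1, h1.2, h2.1, h2.2]
  · have h1 := hp v l
    have h2 := hc v l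
    rw [add_sub_cancel_left, abs_mul, abs_of_nonneg hs0]
    have h3 : |c v l - p v l| ≤ 1 := abs_le.2 ⟨by linarith [h1.2, h2.1], by linarith [h1.1, h2.2]⟩
    nlinarith [abs_nonneg (c v l - p v l)]
  · apply hsP
    simp only [Finset.mem_coe, Multiset.mem_toFinset, Polynomial.mem_roots hP, Polynomial.IsRoot]
    rw [Polynomial.eval_prod]
    exact Finset.prod_eq_zero (by simpa using he) ((hA e s).trans h)

/-- Points of the cube `[0,1]^ι` can be moved by at most `δ` inside the cube so that affine
relations between at most `|ι| + 1` of them are trivial. -/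
theorem exists_general_position {ι : Type*} [Fintype ι] {m : ℕ} (p : Fin m → ι → ℝ)
    (hp : ∀ v l, p v l ∈ Icc (0 : ℝ) 1) {δ : ℝ} (hδ : 0 < δ) :
    ∃ q : Fin m → ι → ℝ, (∀ v l, q v l ∈ Icc (0 : ℝ) 1) ∧ (∀ v l, |q v l - p v l| ≤ δ) ∧
      ∀ (a : Fin m → ℝ) (S : Finset (Fin m)), S.card ≤ Fintype.card ι + 1 →
        (∀ v ∉ S, a v = 0) → ∑ v, a v = 0 → (∀ l, ∑ v, a v * q v l = 0) → a = 0 := by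
  let N := Fintype.card ι
  let ε : ι ≃ Fin N := Fintype.equivFin ι
  -- The `N + 1` dummy points allow any `S` with at most `N + 1` elements to be enlarged to exactly
  -- `N + 1`, as the square determinant requires.
  let p' : Fin (m + (N + 1)) → Fin N → ℝ :=
    Fin.append (fun v l => p v (ε.symm l)) (fun _ _ => 0)
  have hp' : ∀ v l, p' v l ∈ Icc (0 : ℝ) 1 := by
    intro v l
    refine Fin.addCases (fun v => ?_) (fun v => ?_) v
    · simpa [p'] using hp v (ε.symm l)
    · simp [p']
  obtain ⟨q, hq, hqp, hdet⟩ := exists_perturbation_det_ne_zero p' hp' hδ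
  refine ⟨fun v l => q (Fin.castAdd _ v) (ε l), fun v l => hq _ _, fun v l => ?_, ?_⟩
  · simpa [p'] using hqp (Fin.castAdd _ v) (ε l)
  · intro a S hS haS hsum hsumq
    let b : Fin (m + (N + 1)) → ℝ := Fin.append a 0
    obtain ⟨T, hST, hT⟩ := Finset.exists_superset_card_eq
      (s := S.map (Fin.castAddEmb (N + 1))) (n := N + 1) (by simpa using hS) (by simp)
    let e : Fin (N + 1) ≃ T := (T.equivFinOfCardEq hT).symm
    have hb : ∀ v ∉ T, b v = 0 := by
      intro v
      refine Fin.addCases (fun v => ?_) (fun v => ?_) v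
      · intro hv
        simp only [b, Fin.append_left]
        exact haS v fun h => hv (hST (by simpa using h))
      · simp [b]
    have hsumT : ∀ u : Fin (m + (N + 1)) → ℝ,
        ∑ i, b (e i) * u (e i) = ∑ v, a v * u (Fin.castAdd _ v) := by
      intro u
      calc ∑ i, b (e i) * u (e i) = ∑ v : T, b v * u v :=
            Equiv.sum_comp e (fun v : T => b v * u v)
        _ = ∑ v ∈ T, b v * u v := Finset.sum_coe_sort T (fun v => b v * u v)
        _ = ∑ v, b v * u v := Finset.sum_subset (Finset.subset_univ _)
            fun v _ hv => by rw [hb v hv, zero_mul]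
        _ = ∑ v, a v * u (Fin.castAdd _ v) := by
            rw [Fin.sum_univ_add]
            simp [b]
    have hzero := Matrix.eq_zero_of_vecMul_eq_zero
      (hdet (fun i => e i) (Subtype.val_injective.comp e.injective)) (v := fun i => b (e i)) (by
        ext j
        simp only [Matrix.vecMul, dotProduct, Matrix.of_apply, Pi.zero_apply]
        refine Fin.cases ?_ (fun l => ?_) j
        · simpa [hsum] using hsumT 1
        · simp only [Fin.cons_succ]
          rw [hsumT fun v => q v l]
          simpa using hsumq (ε.symm l))
    ext v
    by_cases hv : v ∈ S
    · have h1 : Fin.castAdd (N + 1) v ∈ T := hST (by simpa using hv)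
      have h2 := congrFun hzero (e.symm ⟨_, h1⟩)
      simpa [b] using h2
    · exact haS v hv

/-- A cube-valued map can be approximated by a continuous map that factors through the nerve of
a cover of small order and separates points which do not lie in a common member. -/
theorem exists_approx_separating {X ι : Type*} [TopologicalSpace X] [Fintype ι] {n r : ℕ}
    (w : Fin n → C(X, ℝ)) (hw0 : ∀ v x, 0 ≤ w v x) (hwpos : ∀ x, ∃ v, 0 < w v x)
    (hcard : ∀ x, (Finset.univ.filter (fun v => 0 < w v x)).card ≤ r + 1)
    (hr : 2 * r < Fintype.card ι) (f : X → ι → ℝ) (hf : ∀ x l, f x l ∈ Icc (0 : ℝ) 1)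
    {δ : ℝ} (hδ : 0 < δ)
    (hosc : ∀ v x x', 0 < w v x → 0 < w v x' → ∀ l, |f x l - f x' l| ≤ δ) :
    ∃ Φ : C(X, ι → ℝ), (∀ x l, Φ x l ∈ Icc (0 : ℝ) 1) ∧ (∀ x l, |Φ x l - f x l| ≤ 2 * δ) ∧
      ∀ x x', Φ x = Φ x' → ∃ v, 0 < w v x ∧ 0 < w v x' := by
  classical
  let p : Fin n → ι → ℝ := fun v => if h : ∃ x, 0 < w v x then f h.choose else 0
  have hp : ∀ v l, p v l ∈ Icc (0 : ℝ) 1 := by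
    intro v l
    by_cases h : ∃ x, 0 < w v x
    · simpa [p, h] using hf h.choose l
    · simp [p, h]
  have hpf : ∀ v x, 0 < w v x → ∀ l, |p v l - f x l| ≤ δ := by
    intro v x hx l
    have h : ∃ x, 0 < w v x := ⟨x, hx⟩
    have hpv : p v = f h.choose := dif_pos h
    rw [hpv]
    exact hosc v _ _ h.choose_spec hx l
  obtain ⟨q, hq, hqp, hgen⟩ := exists_general_position p hp hδ
  have hWpos : ∀ x, 0 < ∑ v, w v x := by
    intro x
    obtain ⟨v, hv⟩ := hwpos x
    exact Finset.sum_pos' (fun v _ => hw0 v x) ⟨v, Finset.mem_univ _, hv⟩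
  let lam : Fin n → X → ℝ := fun v x => w v x / ∑ u, w u x
  have hlam0 : ∀ v x, 0 ≤ lam v x := fun v x => div_nonneg (hw0 v x) (hWpos x).le
  have hlamsum : ∀ x, ∑ v, lam v x = 1 := fun x => by
    simp only [lam]
    rw [← Finset.sum_div, div_self (hWpos x).ne']
  have hlampos : ∀ v x, lam v x ≠ 0 ↔ 0 < w v x := by
    intro v x
    simp only [lam, ne_eq, div_eq_zero_iff, (hWpos x).ne', or_false]
    exact ⟨fun h => lt_of_le_of_ne (hw0 v x) (Ne.symm h), fun h => h.ne'⟩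
  have hlamc : ∀ v, Continuous (lam v) := fun v =>
    (w v).continuous.div (by fun_prop) fun x => (hWpos x).ne'
  refine ⟨⟨fun x l => ∑ v, lam v x * q v l, by fun_prop⟩, fun x l => ?_, fun x l => ?_, ?_⟩
  · have := (convex_Icc (0 : ℝ) 1).sum_mem (t := Finset.univ) (w := fun v => lam v x)
      (z := fun v => q v l) (fun v _ => hlam0 v x) (hlamsum x) (fun v _ => hq v l)
    simpa using this
  · have h1 : (∑ v, lam v x * q v l) - f x l = ∑ v, lam v x * (q v l - f x l) := by
      simp only [mul_sub, Finset.sum_sub_distrib, ← Finset.sum_mul, hlamsum, one_mul]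
    calc |(∑ v, lam v x * q v l) - f x l| ≤ ∑ v, |lam v x * (q v l - f x l)| := by
          rw [h1]
          exact Finset.abs_sum_le_sum_abs _ _
      _ ≤ ∑ v, lam v x * (2 * δ) := by
          refine Finset.sum_le_sum fun v _ => ?_
          rw [abs_mul, abs_of_nonneg (hlam0 v x)]
          by_cases h : lam v x = 0
          · simp [h]
          · refine mul_le_mul_of_nonneg_left ?_ (hlam0 v x)
            have h2 := hqp v l
            have h3 := hpf v x ((hlampos v x).1 h) l
            have h4 := abs_sub_le (q v l) (p v l) (f x l)
            linarith
      _ = 2 * δ := by rw [← Finset.sum_mul, hlamsum, one_mul]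
  · intro x x' hxx'
    -- Equal images give an affine relation among at most `2(r + 1) ≤ |ι| + 1` vertices, so the
    -- barycentric coordinates of `x` and `x'` coincide.
    have h0 := hgen (fun v => lam v x - lam v x')
      (Finset.univ.filter (fun v => 0 < w v x) ∪ Finset.univ.filter (fun v => 0 < w v x'))
      ((Finset.card_union_le _ _).trans (by have := hcard x; have := hcard x'; omega))
      (fun v hv => by
        simp only [Finset.mem_union, Finset.mem_filter, Finset.mem_univ, true_and, not_or,
          ← hlampos, not_not] at hv
        rw [hv.1, hv.2, sub_zero])
      (by rw [Finset.sum_sub_distrib, hlamsum, hlamsum, sub_self])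
      (fun l => by
        have := congrFun hxx' l
        simp only [ContinuousMap.coe_mk] at this
        simp only [sub_mul, Finset.sum_sub_distrib, this, sub_self])
    obtain ⟨v, hv⟩ := hwpos x
    refine ⟨v, hv, (hlampos v x').1 ?_⟩
    have h1 := congrFun h0 v
    simp only [Pi.zero_apply, sub_eq_zero] at h1
    rw [← h1]
    exact (hlampos v x).2 hv

end GeneralPosition

/-! ### Density and genericity of embeddings -/

section Embedding

/-- Continuous maps prescribed on finitely many disjoint closed sets can be glued within a
pointwise convex constraint. -/
theorem exists_glue {X ι E : Type*} [MetricSpace X] [NormedAddCommGroup E] [NormedSpace ℝ E]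
    (s : Finset ι) (C : ι → Set X) (hC : ∀ i, IsClosed (C i))
    (hd : (s : Set ι).PairwiseDisjoint C) (a : ι → C(X, E)) (b : C(X, E)) (K : X → Set E)
    (hK : ∀ x, Convex ℝ (K x)) (ha : ∀ i x, a i x ∈ K x) (hb : ∀ x, b x ∈ K x) :
    ∃ k : C(X, E), (∀ x, k x ∈ K x) ∧ ∀ i ∈ s, ∀ x ∈ C i, k x = a i x := by
  classical
  induction s using Finset.induction_on with
  | empty => exact ⟨b, hb, by simp⟩
  | insert j t hj ih =>
    obtain ⟨k, hkK, hk⟩ := ih (hd.subset (by simp))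
    have hdisj : Disjoint (⋃ i ∈ t, C i) (C j) := by
      simp only [Set.disjoint_iUnion_left]
      intro i hi
      exact hd (by simp [hi]) (by simp) (by rintro rfl; exact hj hi)
    obtain ⟨χ, hχ0, hχ1, hχ⟩ := exists_continuous_zero_one_of_isClosed
      (t.finite_toSet.isClosed_biUnion fun i _ => hC i) (hC j) hdisj
    refine ⟨⟨fun x => (1 - χ x) • k x + χ x • a j x, by fun_prop⟩, fun x => ?_, ?_⟩
    · exact hK x (hkK x) (ha j x) (by linarith [(hχ x).2]) (hχ x).1 (by ring)
    · intro i hi x hx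
      rcases Finset.mem_insert.1 hi with rfl | hi
      · simp [hχ1 hx]
      · have : χ x = 0 := hχ0 (by simp only [Set.mem_iUnion]; exact ⟨i, hi, hx⟩)
        simp [this, hk i hi x hx]

theorem exists_finOpenCover_dist_lt (X : Type*) [MetricSpace X] [CompactSpace X] {η : ℝ}
    (hη : 0 < η) :
    ∃ 𝒰 : Set (Set X), IsFinOpenCover 𝒰 ∧ ∀ U ∈ 𝒰, ∀ x ∈ U, ∀ y ∈ U, dist x y < η := by
  obtain ⟨t, -, ht, hcov⟩ :=
    (isCompact_univ (X := X)).finite_cover_balls (half_pos hη)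
  refine ⟨(fun x => Metric.ball x (η / 2)) '' t, ⟨ht.image _, ?_, ?_⟩, ?_⟩
  · rintro _ ⟨x, _, rfl⟩
    exact Metric.isOpen_ball
  · rw [Set.sUnion_image]
    exact Set.univ_subset_iff.1 hcov
  · rintro _ ⟨z, _, rfl⟩ x hx y hy
    have := dist_triangle_right x y z
    rw [Metric.mem_ball] at hx hy
    linarith

variable {G X Y : Type*} [Group G] [MetricSpace X] [CompactSpace X] [MulAction G X]
  [ContinuousConstSMul G X] [MetricSpace Y]

/-- Every `f` is close to some `g` such that `(I_g, π)` separates points at distance `≥ ε`. -/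
theorem exists_close_separating [MulAction G Y] [ContinuousConstSMul G Y] {π : X → Y} (hπ : IsFactorMap G π) {D L : ℕ}
    (hD : RokhlinProperty Y G D) {F : ℕ → Finset G} (hF : IsFolnerSeq F)
    (hL : mdim X F < (L : ℝ≥0∞) / 2) (f : C(X, Cube ((D + 1) * L))) {ε δ : ℝ} (hε : 0 < ε)
    (hδ : 0 < δ) :
    ∃ g : C(X, Cube ((D + 1) * L)), (∀ x j, |(g x j : ℝ) - f x j| ≤ 2 * δ) ∧
      ∀ x x', inducedMap G g x = inducedMap G g x' → π x = π x' → dist x x' < ε := by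
  classical
  obtain ⟨F', hF', hRok⟩ := hD
  obtain ⟨η, hη, hfη⟩ := Metric.uniformContinuous_iff.1
    (CompactSpace.uniformContinuous_of_continuous f.continuous) δ hδ
  -- Mesh `η` controls the oscillation of `f`; mesh `ε` gives the final separation.
  obtain ⟨𝒰, h𝒰, hmesh⟩ := exists_finOpenCover_dist_lt X (lt_min hη hε)
  obtain ⟨n, r, ⟨m, w, hw0, hwpos, hwU, hcard⟩, hr⟩ := exists_hasOrderLe_orbitJoin hF hF' hL h𝒰
  obtain ⟨U, hUo, hUt, hUc⟩ := hRok n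
  set S := F' n
  have hwd : ∀ v x x', 0 < w v x → 0 < w v x' → ∀ g ∈ S, dist (g • x) (g • x') < min η ε := by
    intro v x x' hx hx' g hg
    obtain ⟨W, ⟨V, hV, rfl⟩, hWV⟩ := hwU v
    have h1 := hWV hx
    have h2 := hWV hx'
    simp only [Set.mem_iInter, Set.mem_preimage] at h1 h2
    exact hmesh _ (hV g hg) _ (h1 g hg) _ (h2 g hg)
  have hΦ : ∀ i : Fin (D + 1), ∃ Φ : C(X, S × Fin L → ℝ), (∀ x l, Φ x l ∈ Icc (0 : ℝ) 1) ∧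
      (∀ x l, |Φ x l - f (l.1.1 • x) (finProdFinEquiv (i, l.2))| ≤ 2 * δ) ∧
      ∀ x x', Φ x = Φ x' → ∃ v, 0 < w v x ∧ 0 < w v x' := by
    intro i
    refine exists_approx_separating (ι := S × Fin L) w hw0 hwpos hcard (by simpa [mul_comm] using hr)
      (fun x l => f (l.1.1 • x) (finProdFinEquiv (i, l.2)))
      (fun x l => (f (l.1.1 • x) (finProdFinEquiv (i, l.2))).2) hδ ?_
    intro v x x' hx hx' l
    have h1 := hfη ((hwd v x x' hx hx' l.1 l.1.2).trans_le (min_le_left _ _))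
    exact (dist_le_pi_dist (f (l.1.1 • x)) (f (l.1.1 • x')) (finProdFinEquiv (i, l.2))).trans h1.le
  choose Φ hΦ01 hΦf hΦsep using hΦ
  have hk : ∀ i : Fin (D + 1), ∃ k : C(X, Fin L → ℝ),
      (∀ x, k x ∈ {y : Fin L → ℝ | ∀ l, y l ∈ Icc (0 : ℝ) 1 ∩
        Icc (f x (finProdFinEquiv (i, l)) - 2 * δ : ℝ) (f x (finProdFinEquiv (i, l)) + 2 * δ)}) ∧
      ∀ g ∈ (Finset.univ : Finset S), ∀ x ∈ π ⁻¹' (g.1 • closure (U i)),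
        k x = fun l => Φ i (g.1⁻¹ • x) (g, l) := by
    intro i
    refine exists_glue (Finset.univ : Finset S) (fun g => π ⁻¹' (g.1 • closure (U i)))
      (fun g => (isClosed_closure.smul g.1).preimage hπ.continuous) ?_
      (fun g => ⟨fun x l => Φ i (g.1⁻¹ • x) (g, l), by fun_prop⟩)
      ⟨fun x l => (f x (finProdFinEquiv (i, l)) : ℝ), by fun_prop⟩ _ (fun x => ?_)
      (fun g x l => ⟨hΦ01 i _ _, ?_⟩) (fun x l => ⟨(f x _).2, ?_⟩)
    · intro g _ g' _ hgg'
      exact ((hUt i).2 g.2 g'.2 fun h => hgg' (Subtype.ext h)).preimage π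
    · have : {y : Fin L → ℝ | ∀ l, y l ∈ Icc (0 : ℝ) 1 ∩
          Icc (f x (finProdFinEquiv (i, l)) - 2 * δ : ℝ) (f x (finProdFinEquiv (i, l)) + 2 * δ)}
          = Set.pi univ fun l => Icc (0 : ℝ) 1 ∩
          Icc (f x (finProdFinEquiv (i, l)) - 2 * δ : ℝ) (f x (finProdFinEquiv (i, l)) + 2 * δ) := by
        ext y
        simp
      rw [this]
      exact convex_pi fun l _ => (convex_Icc _ _).inter (convex_Icc _ _)
    · have := abs_le.1 (hΦf i (g.1⁻¹ • x) (g, l))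
      simp only [smul_inv_smul] at this
      constructor <;> simp only [ContinuousMap.coe_mk] <;> linarith [this.1, this.2]
    · constructor <;> simp only [ContinuousMap.coe_mk] <;> linarith
  choose k hkK hkΦ using hk
  let e : Fin (D + 1) × Fin L ≃ Fin ((D + 1) * L) := finProdFinEquiv
  refine ⟨⟨fun x j => ⟨k (e.symm j).1 x (e.symm j).2, (hkK _ x _).1⟩, by fun_prop⟩,
    fun x j => ?_, fun x x' hxx' hπxx' => ?_⟩
  · have h1 := (hkK (e.symm j).1 x (e.symm j).2).2
    have h2 : finProdFinEquiv ((e.symm j).1, (e.symm j).2) = j := e.apply_symm_apply j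
    rw [h2] at h1
    exact abs_le.2 ⟨by simp only [ContinuousMap.coe_mk]; linarith [h1.1],
      by simp only [ContinuousMap.coe_mk]; linarith [h1.2]⟩
  · have hmem : π x ∈ ⋃ i, ⋃ g ∈ S, g • U i := by rw [hUc]; trivial
    simp only [Set.mem_iUnion] at hmem
    obtain ⟨i, h, hh, hx⟩ := hmem
    have hbase : ∀ z, π z = π x → ∀ g : S, (g.1 * h⁻¹) • z ∈ π ⁻¹' (g.1 • closure (U i)) := by
      intro z hz g
      rw [Set.mem_preimage, hπ.map_smul, hz, mul_smul]
      exact Set.smul_mem_smul_set (subset_closure ((Set.mem_smul_set_iff_inv_smul_mem).1 hx))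
    -- Over `π x` the point `h⁻¹ z` lies above the base `U i`, so the orbit values at `g h⁻¹`, `g ∈
    -- S`, read off every component of `Φ i (h⁻¹ z)`.
    have hval : ∀ z, π z = π x → ∀ (g : S) (l : Fin L),
        k i ((g.1 * h⁻¹) • z) l = Φ i (h⁻¹ • z) (g, l) := by
      intro z hz g l
      rw [hkΦ i g (Finset.mem_univ _) _ (hbase z hz g), mul_smul, inv_smul_smul]
    have hΦeq : Φ i (h⁻¹ • x) = Φ i (h⁻¹ • x') := by
      ext ⟨g, l⟩
      rw [← hval x rfl, ← hval x' hπxx'.symm]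
      have h1 := congrArg Subtype.val (congrFun (congrFun hxx' (g.1 * h⁻¹)) (e (i, l)))
      simpa [inducedMap] using h1
    obtain ⟨v, hv, hv'⟩ := hΦsep i _ _ hΦeq
    have := (hwd v _ _ hv hv' h hh).trans_le (min_le_right _ _)
    simpa using this

/-- Separating points at distance at least `ε` is an open condition on `f`. -/
theorem isOpen_setOf_separating {π : X → Y} (hπ : Continuous π) (m : ℕ) (ε : ℝ) :
    IsOpen {f : C(X, Cube m) | ∀ x x', inducedMap G f x = inducedMap G f x' → π x = π x' →
      dist x x' < ε} := by
  have hclosed : IsClosed {p : C(X, Cube m) × (X × X) |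
      (∀ g : G, p.1 (g • p.2.1) = p.1 (g • p.2.2)) ∧ π p.2.1 = π p.2.2 ∧
        ε ≤ dist p.2.1 p.2.2} := by
    simp only [Set.ofPred_and, Set.ofPred_forall]
    refine (isClosed_iInter fun g => isClosed_eq ?_ ?_).inter
      ((isClosed_eq ?_ ?_).inter (isClosed_le ?_ ?_)) <;> fun_prop
  rw [← isClosed_compl_iff]
  -- The bad maps are the projection of a closed set along the compact factor `X × X`.
  convert isClosedMap_fst_of_compactSpace _ hclosed using 1
  ext f
  simp only [Set.mem_compl_iff, Set.mem_ofPred_eq, not_forall, not_lt, Set.mem_image, Prod.exists]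
  constructor
  · rintro ⟨x, x', h1, h2, h3⟩
    exact ⟨f, x, x', ⟨fun g => congrFun h1 g, h2, h3⟩, rfl⟩
  · rintro ⟨_, x, x', ⟨h1, h2, h3⟩, rfl⟩
    exact ⟨x, x', funext h1, h2, h3⟩

/-- On a compact space a continuous map to a Hausdorff space is an embedding as soon as it is
injective. -/
theorem isEmbedding_iff_forall_separating {π : X → Y} (hπ : Continuous π) {m : ℕ}
    (f : C(X, Cube m)) :
    IsEmbedding (fun x : X => (inducedMap G f x, π x)) ↔
      ∀ n : ℕ, ∀ x x', inducedMap G f x = inducedMap G f x' → π x = π x' →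
        dist x x' < 1 / ((n : ℝ) + 1) := by
  constructor
  · intro h n x x' h1 h2
    rw [h.injective (Prod.ext h1 h2), dist_self]
    positivity
  · intro h
    have hcont : Continuous (fun x : X => (inducedMap G f x, π x)) := by
      unfold inducedMap
      fun_prop
    refine (hcont.isClosedEmbedding fun x x' hxx' => ?_).isEmbedding
    rw [Prod.mk.injEq] at hxx'
    refine dist_le_zero.1 (le_of_forall_pos_lt_add fun ε hε => ?_)
    obtain ⟨n, hn⟩ := exists_nat_one_div_lt hε
    have := h n x x' hxx'.1 hxx'.2
    linarith

/-- A finite infimum of natural numbers is attained. -/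
theorem rokhlinProperty_of_dimRok_eq {G Z : Type*} [Group G] [TopologicalSpace Z] [MulAction G Z] {D : ℕ}
    (h : dimRok Z G = D) : RokhlinProperty Z G D := by
  by_contra hne
  have hle : ((D : ℕ∞) + 1) ≤ dimRok Z G := by
    refine le_iInf₂ fun D' hD' => ?_
    have h1 : (D : ℕ∞) ≤ D' := h ▸ iInf₂_le D' hD'
    have h2 : D ≠ D' := by
      rintro rfl
      exact hne hD'
    exact_mod_cast lt_of_le_of_ne (Nat.cast_le.1 h1) h2
  rw [h] at hle
  exact absurd hle (by exact_mod_cast Nat.not_succ_le_self D)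

end Embedding

end TopDyn

end

/-! ### The Baire category argument. -/

theorem mainTheorem7 {G X Y : Type*} [Group G] [Countable G]
    [MetricSpace X] [CompactSpace X] [MulAction G X] [ContinuousConstSMul G X]
    [MetricSpace Y] [CompactSpace Y] [MulAction G Y] [ContinuousConstSMul G Y]
    (π : X → Y) (hπ : TopDyn.IsFactorMap G π)
    (D L : ℕ) (hD : TopDyn.dimRok Y G = (D : ℕ∞))
    (F : ℕ → Finset G) (hF : TopDyn.IsFolnerSeq F)
    (hmdim : TopDyn.mdim X F < (L : ℝ≥0∞) / 2) :
    let A : Set C(X, TopDyn.Cube ((D + 1) * L)) :=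
      {f | IsEmbedding (fun x : X => (TopDyn.inducedMap G f x, π x))}
    IsGδ A ∧ Dense A ∧ A.Nonempty := by
  intro A
  let B : ℕ → Set C(X, TopDyn.Cube ((D + 1) * L)) := fun n =>
    {f | ∀ x x', TopDyn.inducedMap G f x = TopDyn.inducedMap G f x' → π x = π x' →
      dist x x' < 1 / ((n : ℝ) + 1)}
  have hAB : A = ⋂ n, B n := by
    ext f
    simp only [Set.mem_iInter]
    exact TopDyn.isEmbedding_iff_forall_separating hπ.continuous f
  have hopen : ∀ n, IsOpen (B n) := fun n => TopDyn.isOpen_setOf_separating hπ.continuous _ _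
  have hdense : ∀ n, Dense (B n) := by
    intro n f
    rw [Metric.mem_closure_iff]
    intro ρ hρ
    obtain ⟨g, hg, hsep⟩ := TopDyn.exists_close_separating hπ
      (TopDyn.rokhlinProperty_of_dimRok_eq hD) hF hmdim f
      (ε := 1 / ((n : ℝ) + 1)) (δ := ρ / 4) (by positivity) (by positivity)
    refine ⟨g, hsep, ?_⟩
    rw [dist_comm]
    refine lt_of_le_of_lt ((ContinuousMap.dist_le (by positivity)).2 fun x =>
      (dist_pi_le_iff (by positivity)).2 fun j => hg x j) (by linarith)
  have hA : Dense A := by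
    rw [hAB]
    exact dense_iInter_of_isOpen_nat hopen hdense
  refine ⟨?_, hA, ?_⟩
  · rw [hAB]
    exact IsGδ.iInter_of_isOpen hopen
  -- A dense subset is nonempty only if the ambient space is; a constant map settles this, also for
  -- empty `X`.
  · have : Nonempty C(X, TopDyn.Cube ((D + 1) * L)) := ⟨ContinuousMap.const X 0⟩
    exact hA.nonempty
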